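/- Let $d\ge 1$ and $N_A,N_B\ge 0$ be integers with $N=N_A+N_B\ge 1$, and let $0\le k\le N-1$. Consider a chain of $N$ sites with Hilbert space $(\mathbb{C}^d)^{\otimes N}=\mathcal{H}_A\otimes\mathcal{H}_B$, where $A$ consists of the first $N_A$ sites and $B$ of the last $N_B$ sites; put $d_A=d^{N_A}$. Let $T$ be the translation operator, $T|i_1,i_2,\dots,i_N\rangle=|i_N,i_1,\dots,i_{N-1}\rangle$, and let $$\mathbf{T}_k=\sum_{j=0}^{N-1}e^{2\pi i jk/N}\,T^j .$$ Let $\mathcal{E}^k_{\mathrm{TI}}$ be the ensemble of uniformly random translation-invariant states of momentum $k$, i.e. the law of $|\phi\rangle=\mathbf{T}_k|\psi\rangle/\|\mathbf{T}_k|\psi\rangle\|$ where $|\psi\rangle$ is a Haar random pure state (uniformly distributed on the unit sphere of $(\mathbb{C}^d)^{\otimes N}$). Let $\mathcal{B}=\{|b\rangle\}$ be an orthonormal basis of $\mathcal{H}_B$ such that $$\langle b|\mathbf{T}_k|b\rangle=\mathbb{I}_{A}\quad\text{for every } |b\rangle\in\mathcal{B},$$ where $\langle b|\mathbf{T}_k|b\rangle=(\mathbb{I}_A\otimes\langle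 b|)\,\mathbf{T}_k\,(\mathbb{I}_A\otimes|b\rangle)$ is an operator on $\mathcal{H}_A$. Then for every integer $t\ge 1$ the $t$-th moment of the projected ensemble on $A$ is integrable over $\mathcal{E}^k_{\mathrm{TI}}$, and its average is the $t$-th moment of the Haar random states on $A$: $$\mathbb{E}_{|\phi\rangle\in\mathcal{E}^k_{\mathrm{TI}}}\left(\sum_{|b\rangle\in\mathcal{B}}\frac{\left(\langle b|\phi\rangle\langle\phi|b\rangle\right)^{\otimes t}}{\left(\langle\phi|b\rangle\langle b|\phi\rangle\right)^{t-1}}\right)=\int_{\mathrm{Haar}(A)}d\psi\,\left(|\psi\rangle\langle\psi|\right)^{\otimes t}=\frac{\mathbf{\Pi}^A_t}{d_A(d_A+1)\cdots(d_A+t-1)} .$$ Here $\langle b|\phi\rangle=(\mathbb{I}_A\otimes\langle b|)|\phi\rangle\in\mathcal{H}_A$, outcomes $b$ of probability zero contribute $0$ to the sum, and $\mathbf{\Pi}^A_t=\sum_{\pi\in S_t}\pi$ is the sum of the permutation operators on $t$ replicas of $\mathcal{H}_A$, with $\pi(|\psi_1\rangle\otimes\cdots\otimes|\psi_t\rangle)=|\psi_{\pi^{-1}(1)}\rangle\otimes\cdots\otimes|\psi_{\pi^{-1}(t)}\rangle$.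 -/

import Mathlib

open MeasureTheory
open scoped Matrix

noncomputable section

/-- State vectors with coordinates indexed by the computational basis `ι`
(the standard Hilbert space `ℂ^ι` with its Euclidean norm). -/
abbrev Ket (ι : Type*) : Type _ := EuclideanSpace ℂ ι

/-- Computational-basis labels of a chain of `n` sites of local dimension `d`. -/
abbrev Config (d n : ℕ) : Type := Fin n → Fin d

section HaarStates

variable (ι : Type*) [Fintype ι]

/-- The law of a Haar random pure state: the uniform probability measure on the unit sphere
of `ℂ^ι`, that is, the surface measure induced by Lebesgue (additive Haar) measure, divided by
its total mass. -/
def haarState : Measure (Metric.sphere (0 : Ket ι) 1) :=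
  ((Measure.addHaar : Measure (Ket ι)).toSphere Set.univ)⁻¹ •
    (Measure.addHaar : Measure (Ket ι)).toSphere

end HaarStates

section Operators

variable {ι : Type*}

/-- The (not necessarily normalized) rank-one operator `|ψ⟩⟨ψ|`. -/
def ketBra (ψ : Ket ι) : Matrix ι ι ℂ :=
  Matrix.of fun i j => ψ i * star (ψ j)

/-- The `t`-fold tensor power `M ⊗ ⋯ ⊗ M` of an operator, in the product basis. -/
def tensorPow (t : ℕ) (M : Matrix ι ι ℂ) : Matrix (Fin t → ι) (Fin t → ι) ℂ :=
  Matrix.of fun i j => ∏ s, M (i s) (j s)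

/-- The permutation operator on `t` replicas,
`π (ψ₁ ⊗ ⋯ ⊗ ψₜ) = ψ_{π⁻¹(1)} ⊗ ⋯ ⊗ ψ_{π⁻¹(t)}`. -/
def replicaPerm (ι : Type*) [DecidableEq ι] {t : ℕ} (π : Equiv.Perm (Fin t)) :
    Matrix (Fin t → ι) (Fin t → ι) ℂ :=
  Matrix.of fun i j => if i = (fun s => j (π⁻¹ s)) then 1 else 0

/-- `Π_t = ∑_{π ∈ S_t} π`, the (unnormalized) symmetrizer on `t` replicas. -/
def symmetrizer (ι : Type*) [DecidableEq ι] (t : ℕ) : Matrix (Fin t → ι) (Fin t → ι) ℂ :=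
  ∑ π : Equiv.Perm (Fin t), replicaPerm ι π

/-- The `t`-th moment `∫ dψ (|ψ⟩⟨ψ|)^{⊗ t}` of the ensemble of Haar random states. -/
def haarMoment (ι : Type*) [Fintype ι] (t : ℕ) : Matrix (Fin t → ι) (Fin t → ι) ℂ :=
  Matrix.of fun i j => ∫ ψ, tensorPow t (ketBra (ψ : Ket ι)) i j ∂(haarState ι)

end Operators

section Translation

variable (d N : ℕ)

/-- The lattice translation operator `T |i₁, i₂, …, i_N⟩ = |i_N, i₁, …, i_{N-1}⟩`. -/
def translation : Matrix (Config d N) (Config d N) ℂ :=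
  Matrix.of fun i' i => if i' = (fun n => i ((finRotate N).symm n)) then 1 else 0

/-- `T_k = ∑_{j=0}^{N-1} e^{2π i j k / N} T^j`. -/
def momentumOp (k : ℕ) : Matrix (Config d N) (Config d N) ℂ :=
  ∑ j ∈ Finset.range N,
    Complex.exp (2 * Real.pi * Complex.I * j * k / N) • translation d N ^ j

/-- The map `|ψ⟩ ↦ T_k |ψ⟩ / ‖T_k |ψ⟩‖` onto momentum-`k` states. -/
def toMomentum (k : ℕ) (ψ : Ket (Config d N)) : Ket (Config d N) :=
  ((‖Matrix.toEuclideanLin (momentumOp d N k) ψ‖⁻¹ : ℝ) : ℂ) •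
    Matrix.toEuclideanLin (momentumOp d N k) ψ

/-- The ensemble of uniformly random translation-invariant states of momentum `k`: the law of
`T_k |ψ⟩ / ‖T_k |ψ⟩‖` for a Haar random state `|ψ⟩`. -/
def momentumEnsemble (k : ℕ) : Measure (Ket (Config d N)) :=
  (haarState (Config d N)).map
    fun ψ : Metric.sphere (0 : Ket (Config d N)) 1 => toMomentum d N k (ψ : Ket (Config d N))

end Translation

section Measurement

variable {d NA NB : ℕ}

/-- The partial overlap `(I_A ⊗ ⟨b|) |φ⟩`, a vector on `A` (the first `NA` sites), for a vector
`b` on `B` (the last `NB` sites). -/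
def partialOverlap (b : Ket (Config d NB)) (φ : Ket (Config d (NA + NB))) :
    Ket (Config d NA) :=
  WithLp.toLp 2 fun a => ∑ s : Config d NB, star (b s) * φ (Fin.append a s)

/-- The operator `⟨b| M |b⟩ = (I_A ⊗ ⟨b|) M (I_A ⊗ |b⟩)` on `A`. -/
def partialExpectation (b : Ket (Config d NB))
    (M : Matrix (Config d (NA + NB)) (Config d (NA + NB)) ℂ) :
    Matrix (Config d NA) (Config d NA) ℂ :=
  Matrix.of fun a a' => ∑ s : Config d NB, ∑ s' : Config d NB,
    star (b s) * M (Fin.append a s) (Fin.append a' s') * b s'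

/-- The `t`-th moment of the projected ensemble on `A` obtained from the generator state `φ` by
measuring `B` in the orthonormal basis `𝓑`:
`∑_b (⟨b|φ⟩⟨φ|b⟩)^{⊗ t} / (⟨φ|b⟩⟨b|φ⟩)^{t-1}`, for `t ≥ 1`.
An outcome of probability zero contributes zero. -/
def projectedMoment {κ : Type*} [Fintype κ]
    (𝓑 : OrthonormalBasis κ ℂ (Ket (Config d NB))) (t : ℕ) (φ : Ket (Config d (NA + NB))) :
    Matrix (Fin t → Config d NA) (Fin t → Config d NA) ℂ :=
  ∑ b, (((‖partialOverlap (𝓑 b) φ‖ ^ 2) ^ (t - 1) : ℝ) : ℂ)⁻¹ •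
    tensorPow t (ketBra (partialOverlap (𝓑 b) φ))

/-- The average of the `t`-th moment of the projected ensemble over the random generator states
of momentum `k`. -/
def meanProjectedMoment {κ : Type*} [Fintype κ]
    (𝓑 : OrthonormalBasis κ ℂ (Ket (Config d NB))) (NA t k : ℕ) :
    Matrix (Fin t → Config d NA) (Fin t → Config d NA) ℂ :=
  Matrix.of fun i j => ∫ φ, projectedMoment 𝓑 t φ i j ∂(momentumEnsemble d (NA + NB) k)

end Measurement

end

/-!
The operator `T_k` is `N` times the orthogonal projection onto the momentum-`k` space
(`momentumOp_conjTranspose_mul_self`), because it is the geometric sum of a unitary of order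
dividing `N`.  If `⟨b| T_k |b⟩ = 1`, then `X = ⟨b| T_k / √N` satisfies `X X† = 1`, so `W = X†` is
an isometric embedding of `H_A` into the momentum-`k` space, and every state splits orthogonally as
`ψ = W x + y` with `x = X ψ`.  Up to a positive factor, `⟨b|φ⟩` is `x`, and its norm, the square
root of the probability of the outcome `b`, depends on `x` only through `‖x‖`.  Since the Haar
measure is rotationally invariant in `x`, the direction of `⟨b|φ⟩` is Haar random on `A` and
independent of the probability of `b` (`integral_mul_comp_haarState`,
`integral_outcomeMoment_normalizedImage`).  Hence the contribution of `b` to the mean moment is the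
Haar moment times the mean probability of `b`, and the probabilities add up to `1`.  They need not
be equal.

Averages over the sphere are computed as integrals over the whole space with the weight
`exp (-‖x‖²)`: polar coordinates relate the two (`integral_angular_mul_radial_eq_haarState`), while
Fubini's theorem applies to the latter.  No group integration or representation theory of the
unitary group is needed.  The same device turns the Haar moments into products of one-variable
Gaussian moments, and these count the permutations that contribute to the matrix elements of the
symmetrizer (`haarMoment_eq_symmetrizer`).
-/

/-! ### Polar coordinates and the uniform measure on the sphere -/

/-- Polar coordinates: the integral of an angular function times a radial function factorizes. -/
theorem integral_angular_mul_radial {E : Type*} [NormedAddCommGroup E] [NormedSpace ℝ E]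
    [MeasurableSpace E] [BorelSpace E] [FiniteDimensional ℝ E] [Nontrivial E]
    (μ : Measure E) [μ.IsAddHaarMeasure] (g : E → ℂ)
    (hg : ∀ (r : ℝ) (x : E), 0 < r → g (r • x) = g x) (H : ℝ → ℂ) :
    ∫ x, g x * H ‖x‖ ∂μ =
      (∫ u : Metric.sphere (0 : E) 1, g u ∂μ.toSphere) *
        ∫ r : Set.Ioi (0 : ℝ), H r ∂Measure.volumeIoiPow (Module.finrank ℝ E - 1) := by
  have h1 := μ.measurePreserving_homeomorphUnitSphereProd.integral_comp
    (Homeomorph.measurableEmbedding _)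
    (fun p : Metric.sphere (0 : E) 1 × Set.Ioi (0 : ℝ) => g p.1 * H p.2)
  rw [integral_prod_mul (fun u : Metric.sphere (0 : E) 1 => g u)
    (fun r : Set.Ioi (0 : ℝ) => H r)] at h1
  have h2 := integral_subtype_comap (μ := μ) (measurableSet_singleton (0 : E)).compl
    (fun x => g x * H ‖x‖)
  rw [restrict_compl_singleton] at h2
  rw [← h1, ← h2]
  refine integral_congr_ae (Filter.Eventually.of_forall fun x => ?_)
  have hx : (0 : ℝ) < ‖(x : E)‖ := norm_pos_iff.2 x.2
  simp [hg _ (x : E) (inv_pos.2 hx)]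

section HaarState

variable {ι : Type*} [Fintype ι]

instance isProbabilityMeasure_haarState [Nonempty ι] : IsProbabilityMeasure (haarState ι) := by
  constructor
  rw [haarState, Measure.smul_apply, smul_eq_mul]
  exact ENNReal.inv_mul_cancel (Measure.measure_univ_ne_zero.2 (Measure.toSphere_ne_zero _))
    (measure_ne_top _ _)

/-- Averages over Haar random states are averages of scale-invariant functions against any
radial weight. -/
theorem integral_angular_mul_radial_eq_haarState [Nonempty ι] (g : Ket ι → ℂ)
    (hg : ∀ (r : ℝ) (x : Ket ι), 0 < r → g (r • x) = g x) (H : ℝ → ℂ) :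
    ∫ x, g x * H ‖x‖ ∂(Measure.addHaar : Measure (Ket ι)) =
      (∫ ψ, g (ψ : Ket ι) ∂haarState ι) *
        ∫ x, H ‖x‖ ∂(Measure.addHaar : Measure (Ket ι)) := by
  have h1 := integral_angular_mul_radial (Measure.addHaar : Measure (Ket ι)) g hg H
  have h2 := integral_angular_mul_radial (Measure.addHaar : Measure (Ket ι)) (fun _ => 1)
    (fun _ _ _ => rfl) H
  simp only [one_mul, integral_const] at h2
  rw [h1, h2, haarState, integral_smul_measure, ENNReal.toReal_inv, Complex.real_smul,
    Complex.real_smul, mul_one, mul_mul_mul_comm, ← measureReal_def, Complex.ofReal_inv,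
    inv_mul_cancel₀, one_mul]
  rw [ne_eq, Complex.ofReal_eq_zero, measureReal_eq_zero_iff]
  exact Measure.measure_univ_ne_zero.2 (Measure.toSphere_ne_zero _)

end HaarState

/-! ### Gaussian moments -/

theorem Complex.integral_pow_mul_star_pow_mul_exp (n m : ℕ) :
    ∫ z : ℂ, z ^ n * star z ^ m * Real.exp (-‖z‖ ^ 2) =
      if n = m then (Real.pi * n.factorial : ℂ) else 0 := by
  split_ifs with h
  · subst h
    have h1 := Complex.integral_rpow_mul_exp_neg_rpow (p := 2) (q := 2 * n) (by norm_num)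
      (by have : (0 : ℝ) ≤ n := n.cast_nonneg
          linarith)
    have h2 : ∀ z : ℂ, z ^ n * star z ^ n * Real.exp (-‖z‖ ^ 2) =
        ((‖z‖ ^ (2 * n : ℝ) * Real.exp (-‖z‖ ^ (2 : ℝ)) : ℝ) : ℂ) := fun z => by
      rw [← mul_pow, Complex.star_def, Complex.mul_conj, Complex.normSq_eq_norm_sq]
      rw [Real.rpow_mul (norm_nonneg _)]
      simp
    simp_rw [h2]
    rw [integral_complex_ofReal, h1,
      show (2 * (n : ℝ) + 2) / 2 = n + 1 by ring, Real.Gamma_nat_eq_factorial]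
    simp
  · obtain ⟨u, hu⟩ : ∃ u : Circle, (u : ℂ) ^ n * star (u : ℂ) ^ m = -1 := by
      have hnm : ((n : ℂ) - m) ≠ 0 := sub_ne_zero.2 (by exact_mod_cast h)
      refine ⟨Circle.exp (Real.pi / (n - m)), ?_⟩
      rw [Complex.star_def, ← Circle.coe_inv_eq_conj, ← Circle.exp_neg, Circle.coe_exp,
        Circle.coe_exp, ← Complex.exp_nat_mul, ← Complex.exp_nat_mul, ← Complex.exp_add,
        ← Complex.exp_pi_mul_I]
      congr 1
      push_cast
      field_simp
      ring
    have h1 := ((rotation u).measurePreserving.integral_comp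
      (rotation u).toHomeomorph.measurableEmbedding
      (fun z : ℂ => z ^ n * star z ^ m * Real.exp (-‖z‖ ^ 2)))
    have h2 : ∀ z : ℂ, (rotation u z) ^ n * star (rotation u z) ^ m *
        (Real.exp (-‖rotation u z‖ ^ 2) : ℂ) = -(z ^ n * star z ^ m * Real.exp (-‖z‖ ^ 2)) := by
      intro z
      rw [LinearIsometryEquiv.norm_map, rotation_apply, star_mul', mul_pow, mul_pow]
      linear_combination (z ^ n * star z ^ m * Real.exp (-‖z‖ ^ 2)) * hu
    simp_rw [h2, integral_neg] at h1
    exact self_eq_neg.1 h1.symm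

/-- Haar integrals transform under a continuous linear equivalence by a nonzero constant. -/
theorem ContinuousLinearEquiv.exists_integral_comp_eq {E F : Type*}
    [NormedAddCommGroup E] [NormedSpace ℝ E] [MeasurableSpace E] [BorelSpace E]
    [NormedAddCommGroup F] [NormedSpace ℝ F] [MeasurableSpace F] [BorelSpace F]
    [FiniteDimensional ℝ F] (L : E ≃L[ℝ] F)
    (μ : Measure E) [μ.IsAddHaarMeasure] (ν : Measure F) [ν.IsAddHaarMeasure] :
    ∃ c : ℝ, c ≠ 0 ∧ ∀ f : F → ℂ, (∫ x, f (L x) ∂μ = c * ∫ y, f y ∂ν) ∧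
      (Integrable f ν → Integrable (fun x => f (L x)) μ) := by
  have : ProperSpace F := FiniteDimensional.proper ℝ F
  have hL : MeasurableEmbedding L := L.toHomeomorph.measurableEmbedding
  have hmap : μ.map L = (μ.map L).addHaarScalarFactor ν • ν :=
    Measure.isAddLeftInvariant_eq_smul _ _
  set c := (μ.map L).addHaarScalarFactor ν with hc
  refine ⟨c, ?_, fun f => ⟨?_, fun hf => ?_⟩⟩
  · rw [NNReal.coe_ne_zero]
    rintro h
    rw [h, zero_smul] at hmap
    exact NeZero.ne (μ.map L) hmap
  · rw [← hL.integral_map, hmap, integral_smul_nnreal_measure, NNReal.smul_def, Complex.real_smul]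
  · have : Integrable f (μ.map L) := by
      rw [hmap]
      exact hf.smul_measure_nnreal
    exact hL.integrable_map_iff.1 this

section GaussianMoments

variable {ι : Type*} [Fintype ι]

/-- Complex Gaussian coordinates are independent, with `E[zⁿ z̄ᵐ] = δₙₘ n!`. -/
theorem integral_monomial_mul_exp_neg_norm_sq (n m : ι → ℕ) :
    ∫ x : Ket ι, (∏ a, (x a ^ n a * star (x a) ^ m a)) * (Real.exp (-‖x‖ ^ 2) : ℂ)
        ∂(Measure.addHaar : Measure (Ket ι)) =
      (∏ a, if n a = m a then ((n a).factorial : ℂ) else 0) *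
        ∫ x : Ket ι, (Real.exp (-‖x‖ ^ 2) : ℂ) ∂(Measure.addHaar : Measure (Ket ι)) := by
  let L : (ι → ℂ) ≃L[ℝ] Ket ι := (PiLp.continuousLinearEquiv 2 ℝ fun _ : ι => ℂ).symm
  obtain ⟨c, hc, h⟩ := L.exists_integral_comp_eq
    (volume : Measure (ι → ℂ)) (Measure.addHaar : Measure (Ket ι))
  have hc' : (c : ℂ) ≠ 0 := by exact_mod_cast hc
  have key : ∀ n m : ι → ℕ,
      c * ∫ x : Ket ι, (∏ a, (x a ^ n a * star (x a) ^ m a)) * (Real.exp (-‖x‖ ^ 2) : ℂ)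
        ∂(Measure.addHaar : Measure (Ket ι)) =
      ∏ a, if n a = m a then (Real.pi * (n a).factorial : ℂ) else 0 := by
    intro n m
    rw [← (h _).1]
    simp_rw [← Complex.integral_pow_mul_star_pow_mul_exp]
    rw [← integral_fintype_prod_volume_eq_prod
      (f := fun a z => z ^ n a * star z ^ m a * (Real.exp (-‖z‖ ^ 2) : ℂ))]
    refine integral_congr_ae (Filter.Eventually.of_forall fun x => ?_)
    simp only [EuclideanSpace.norm_sq_eq]
    rw [← Finset.sum_neg_distrib, Real.exp_sum, Complex.ofReal_prod, ← Finset.prod_mul_distrib]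
    rfl
  have h0 := key 0 0
  simp only [Pi.zero_apply, pow_zero, mul_one, Finset.prod_const_one, one_mul, if_true,
    Nat.factorial_zero, Nat.cast_one] at h0
  apply mul_left_cancel₀ hc'
  rw [key, mul_left_comm, h0, ← Finset.prod_mul_distrib]
  exact Finset.prod_congr rfl fun a _ => by split_ifs <;> ring

theorem integrable_exp_neg_norm_sq [Nonempty ι] :
    Integrable (fun x : Ket ι => Real.exp (-‖x‖ ^ 2)) Measure.addHaar := by
  rw [integrable_fun_norm_addHaar Measure.addHaar (f := fun r => Real.exp (-r ^ 2))]
  have := integrableOn_rpow_mul_exp_neg_rpow (p := 2)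
    (s := ((Module.finrank ℝ (Ket ι) - 1 : ℕ) : ℝ))
    (by have : (0:ℝ) ≤ ((Module.finrank ℝ (Ket ι) - 1 : ℕ) : ℝ) := Nat.cast_nonneg _
        linarith) (by norm_num)
  simpa using this

theorem integral_exp_neg_norm_sq_ne_zero [Nonempty ι] :
    ∫ x : Ket ι, (Real.exp (-‖x‖ ^ 2) : ℂ) ∂(Measure.addHaar : Measure (Ket ι)) ≠ 0 := by
  rw [integral_complex_ofReal, Complex.ofReal_ne_zero]
  exact (integral_exp_pos integrable_exp_neg_norm_sq).ne'

/-- The radial moments of the Gaussian weight: a ratio `Γ(D + t) / Γ(D)` of Gamma values. -/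
theorem integral_norm_pow_mul_exp_neg_norm_sq [Nonempty ι] (t : ℕ) :
    ∫ x : Ket ι, ((‖x‖ ^ (2 * t) * Real.exp (-‖x‖ ^ 2) : ℝ) : ℂ)
        ∂(Measure.addHaar : Measure (Ket ι)) =
      (∏ m ∈ Finset.range t, ((Fintype.card ι : ℂ) + m)) *
        ∫ x : Ket ι, (Real.exp (-‖x‖ ^ 2) : ℂ) ∂(Measure.addHaar : Measure (Ket ι)) := by
  set D := Fintype.card ι with hD
  have hD0 : 0 < D := Fintype.card_pos
  have hfin : Module.finrank ℝ (Ket ι) = 2 * D := by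
    rw [finrank_real_of_complex, finrank_euclideanSpace]
  have radial : ∀ t : ℕ, ∫ x : Ket ι, ‖x‖ ^ (2 * t) * Real.exp (-‖x‖ ^ 2)
        ∂(Measure.addHaar : Measure (Ket ι)) =
      (2 * D) • (Measure.addHaar : Measure (Ket ι)).real (Metric.ball 0 1) •
        (1 / 2 * Real.Gamma (D + t)) := by
    intro t
    rw [integral_fun_norm_addHaar Measure.addHaar
      (fun r => r ^ (2 * t) * Real.exp (-r ^ 2)), hfin]
    congr 2
    have := integral_rpow_mul_exp_neg_rpow (p := 2) (q := ((2 * D - 1 + 2 * t : ℕ) : ℝ))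
      (by norm_num) (by have : (0:ℝ) ≤ ((2 * D - 1 + 2 * t : ℕ) : ℝ) := Nat.cast_nonneg _
                        linarith)
    have h2 : (((2 * D - 1 + 2 * t : ℕ) : ℝ) + 1) / 2 = D + t := by
      have : 2 * D - 1 + 2 * t + 1 = 2 * (D + t) := by omega
      have : (((2 * D - 1 + 2 * t : ℕ) : ℝ) + 1) = 2 * (D + t) := by exact_mod_cast this
      rw [this]
      ring
    rw [h2] at this
    rw [← this]
    refine setIntegral_congr_fun measurableSet_Ioi fun x _ => ?_
    simp only [Real.rpow_natCast, Real.rpow_two, smul_eq_mul]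
    rw [pow_add, mul_assoc]
  have gamma : ∀ t : ℕ, Real.Gamma (D + t) =
      (∏ m ∈ Finset.range t, ((D : ℝ) + m)) * Real.Gamma D := by
    intro t
    induction t with
    | zero => simp
    | succ t ih =>
      rw [Finset.prod_range_succ, Nat.cast_succ, ← add_assoc, Real.Gamma_add_one (by positivity),
        ih]
      ring
  have h0 := radial 0
  simp only [mul_zero, pow_zero, one_mul, Nat.cast_zero, add_zero] at h0
  rw [integral_complex_ofReal, integral_complex_ofReal, h0, radial t, gamma t]
  push_cast
  simp only [nsmul_eq_mul, smul_eq_mul]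
  push_cast
  ring

end GaussianMoments

/-! ### Moments of Haar random states -/

theorem tensorPow_ketBra_apply {ι : Type*} {t : ℕ} (ψ : Ket ι) (i j : Fin t → ι) :
    tensorPow t (ketBra ψ) i j = ∏ s, ψ (i s) * star (ψ (j s)) := rfl

theorem continuous_tensorPow_ketBra {ι : Type*} {t : ℕ} (i j : Fin t → ι) :
    Continuous fun ψ : Ket ι => tensorPow t (ketBra ψ) i j := by
  simp only [tensorPow_ketBra_apply]
  fun_prop

theorem tensorPow_ketBra_smul {ι : Type*} {t : ℕ} (c : ℂ) (ψ : Ket ι) :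
    tensorPow t (ketBra (c • ψ)) = ((‖c‖ ^ (2 * t) : ℝ) : ℂ) • tensorPow t (ketBra ψ) := by
  ext i j
  have h : ∀ s, (c • ψ) (i s) * star ((c • ψ) (j s)) =
      ((‖c‖ ^ 2 : ℝ) : ℂ) * (ψ (i s) * star (ψ (j s))) := fun s => by
    rw [← Complex.normSq_eq_norm_sq, ← Complex.mul_conj, PiLp.smul_apply, PiLp.smul_apply,
      smul_eq_mul, smul_eq_mul, star_mul', ← Complex.star_def]
    ring
  rw [Matrix.smul_apply, tensorPow_ketBra_apply, Finset.prod_congr rfl fun s _ => h s,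
    Finset.prod_mul_distrib, Finset.prod_const, Finset.card_univ, Fintype.card_fin,
    tensorPow_ketBra_apply, pow_mul, Complex.ofReal_pow _ t, smul_eq_mul]

section Moments

variable {ι : Type*} [Fintype ι]

theorem norm_tensorPow_ketBra_le {t : ℕ} (ψ : Ket ι) (i j : Fin t → ι) :
    ‖tensorPow t (ketBra ψ) i j‖ ≤ ‖ψ‖ ^ (2 * t) := by
  rw [tensorPow_ketBra_apply, norm_prod, pow_mul]
  calc ∏ s, ‖ψ (i s) * star (ψ (j s))‖ ≤ ∏ _s : Fin t, ‖ψ‖ ^ 2 := by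
        refine Finset.prod_le_prod (fun _ _ => norm_nonneg _) fun s _ => ?_
        rw [norm_mul, norm_star, sq]
        exact mul_le_mul (PiLp.norm_apply_le _ _) (PiLp.norm_apply_le _ _) (norm_nonneg _)
          (norm_nonneg _)
    _ = _ := by simp

variable [DecidableEq ι]

/-- A matrix element of `(|ψ⟩⟨ψ|)^{⊗ t}` as a monomial in the coordinates: the exponent of `ψ a`
(of its conjugate) is the number of occurrences of `a` in the row (column) index. -/
theorem tensorPow_ketBra_eq_monomial {t : ℕ} (ψ : Ket ι) (i j : Fin t → ι) :
    tensorPow t (ketBra ψ) i j =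
      ∏ a, (ψ a ^ Fintype.card {s // i s = a} * star (ψ a) ^ Fintype.card {s // j s = a}) := by
  have h : ∀ (f : ι → ℂ) (k : Fin t → ι),
      ∏ s, f (k s) = ∏ a, f a ^ Fintype.card {s // k s = a} := fun f k => by
    rw [← Finset.prod_fiberwise_of_maps_to (g := k) (t := Finset.univ) fun _ _ => Finset.mem_univ _]
    refine Finset.prod_congr rfl fun a _ => ?_
    rw [Finset.prod_congr rfl (g := fun _ => f a) fun s hs => by rw [(Finset.mem_filter.1 hs).2],
      Finset.prod_const, Fintype.card_subtype]
  rw [tensorPow_ketBra_apply, Finset.prod_mul_distrib, h (fun a => ψ a) i,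
    h (fun a => star (ψ a)) j, Finset.prod_mul_distrib]

/-- The matrix element of the symmetrizer counts the permutations matching two words. -/
theorem symmetrizer_apply {t : ℕ} (i j : Fin t → ι) :
    symmetrizer ι t i j = ∏ a, if Fintype.card {s // i s = a} = Fintype.card {s // j s = a} then
      ((Fintype.card {s // i s = a}).factorial : ℂ) else 0 := by
  have hcount : symmetrizer ι t i j =
      (Fintype.card {π : Equiv.Perm (Fin t) // i ∘ π = j} : ℂ) := by
    rw [symmetrizer, Matrix.sum_apply, Fintype.card_subtype, ← Finset.sum_boole]
    refine Finset.sum_congr rfl fun π _ => ?_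
    rw [replicaPerm, Matrix.of_apply]
    congr 1
    rw [eq_iff_iff]
    constructor
    · intro h
      ext s
      simp [h]
    · intro h
      ext s
      simp [← h]
  rw [hcount]
  by_cases h : ∀ a, Fintype.card {s // i s = a} = Fintype.card {s // j s = a}
  · -- A permutation `e` with `i ∘ e = j` identifies the solution set with the stabilizer of `i`.
    let e : Fin t ≃ Fin t := (Equiv.sigmaFiberEquiv j).symm.trans
      ((Equiv.sigmaCongrRight fun a => Fintype.equivOfCardEq (h a).symm).trans
        (Equiv.sigmaFiberEquiv i))
    have he : i ∘ e = j := by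
      ext s
      exact ((Fintype.equivOfCardEq (h (j s)).symm) ⟨s, rfl⟩).2
    have hcard : Fintype.card {π : Equiv.Perm (Fin t) // i ∘ π = j} =
        Fintype.card {π : Equiv.Perm (Fin t) // i ∘ π = i} := by
      refine Fintype.card_congr (Equiv.subtypeEquiv (Equiv.mulRight e⁻¹) fun π => ?_)
      constructor
      · intro hπ
        ext s
        have := congrFun (hπ.trans he.symm) (e⁻¹ s)
        simpa using this
      · intro hπ
        rw [← he]
        ext s
        have := congrFun hπ (e s)
        simpa using this
    rw [hcard, DomMulAct.stabilizer_card, Nat.cast_prod]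
    exact Finset.prod_congr rfl fun a _ => by rw [if_pos (h a)]
  · push Not at h
    obtain ⟨a, ha⟩ := h
    rw [Finset.prod_eq_zero (Finset.mem_univ a) (if_neg ha), Nat.cast_eq_zero,
      Fintype.card_eq_zero_iff]
    refine ⟨fun ⟨π, hπ⟩ => ha ?_⟩
    refine (Fintype.card_congr (Equiv.subtypeEquiv π fun s => ?_)).symm
    rw [← hπ]
    rfl

/-- The moments of Haar random states are read off from Gaussian moments: the radial part of the
Gaussian integral gives the normalization, and the monomial integrals give the matrix elements of
the symmetrizer. -/
theorem haarMoment_eq_symmetrizer [Nonempty ι] (t : ℕ) :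
    haarMoment ι t =
      (∏ m ∈ Finset.range t, ((Fintype.card ι : ℂ) + m))⁻¹ • symmetrizer ι t := by
  ext i j
  have hZ := integral_exp_neg_norm_sq_ne_zero (ι := ι)
  set Z := ∫ x : Ket ι, (Real.exp (-‖x‖ ^ 2) : ℂ) ∂(Measure.addHaar : Measure (Ket ι)) with hZdef
  have hD : (∏ m ∈ Finset.range t, ((Fintype.card ι : ℂ) + m)) ≠ 0 := by
    refine Finset.prod_ne_zero_iff.2 fun m _ => ?_
    have : 0 < Fintype.card ι := Fintype.card_pos
    exact_mod_cast (by omega : Fintype.card ι + m ≠ 0)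
  have hnum := integral_monomial_mul_exp_neg_norm_sq (ι := ι)
    (fun a => Fintype.card {s // i s = a}) (fun a => Fintype.card {s // j s = a})
  rw [← symmetrizer_apply] at hnum
  -- The monomial of degree `2 t` is a scale-invariant function times `r ^ (2 * t)`.
  have hpolar := integral_angular_mul_radial_eq_haarState (ι := ι)
    (fun x => ((‖x‖ ^ (2 * t) : ℝ) : ℂ)⁻¹ * tensorPow t (ketBra x) i j)
    (fun r x hr => by
      have : r • x = (r : ℂ) • x := (Complex.coe_smul r x).symm
      rw [this, tensorPow_ketBra_smul, Matrix.smul_apply, norm_smul, mul_pow, smul_eq_mul,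
        Complex.ofReal_mul]
      have : ((‖(r : ℂ)‖ ^ (2 * t) : ℝ) : ℂ) ≠ 0 := by
        rw [Complex.ofReal_ne_zero]
        exact pow_ne_zero _ (norm_ne_zero_iff.2 (by exact_mod_cast hr.ne'))
      field_simp)
    (fun r => ((r ^ (2 * t) * Real.exp (-r ^ 2) : ℝ) : ℂ))
  rw [integral_norm_pow_mul_exp_neg_norm_sq] at hpolar
  have hL : ∀ x : Ket ι, ((‖x‖ ^ (2 * t) : ℝ) : ℂ)⁻¹ * tensorPow t (ketBra x) i j *
      ((‖x‖ ^ (2 * t) * Real.exp (-‖x‖ ^ 2) : ℝ) : ℂ) =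
      (∏ a, (x a ^ Fintype.card {s // i s = a} * star (x a) ^ Fintype.card {s // j s = a})) *
        (Real.exp (-‖x‖ ^ 2) : ℂ) := fun x => by
    rw [← tensorPow_ketBra_eq_monomial]
    -- At `x = 0` with `t ≥ 1` the inverse is the junk value `0`, but the monomial vanishes too.
    by_cases h : ‖x‖ ^ (2 * t) = 0
    · have : tensorPow t (ketBra x) i j = 0 :=
        norm_le_zero_iff.1 (h ▸ norm_tensorPow_ketBra_le x i j)
      rw [this]
      simp
    · have : ((‖x‖ ^ (2 * t) : ℝ) : ℂ) ≠ 0 := by exact_mod_cast h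
      rw [Complex.ofReal_mul]
      field_simp
  simp only [hL] at hpolar
  have hS : ∫ ψ : Metric.sphere (0 : Ket ι) 1, ((‖(ψ : Ket ι)‖ ^ (2 * t) : ℝ) : ℂ)⁻¹ *
      tensorPow t (ketBra (ψ : Ket ι)) i j ∂haarState ι = haarMoment ι t i j := by
    rw [haarMoment, Matrix.of_apply]
    refine integral_congr_ae (Filter.Eventually.of_forall fun ψ => ?_)
    simp
  rw [hS, hnum, ← mul_assoc] at hpolar
  have := mul_right_cancel₀ hZ hpolar
  rw [Matrix.smul_apply, smul_eq_mul, this, mul_comm, mul_assoc, mul_inv_cancel₀ hD, mul_one]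

end Moments

/-! ### Directions of isometric compressions of Haar random states -/

section Compression

variable {ι α : Type*} [Fintype ι] [Fintype α] [Nonempty ι] [Nonempty α]

theorem integrable_bounded_mul_exp_neg_norm_sq {f : Ket ι → ℂ} (hf : Measurable f) {C : ℝ}
    (hC : ∀ x, ‖f x‖ ≤ C) :
    Integrable (fun x => f x * (Real.exp (-‖x‖ ^ 2) : ℂ)) (Measure.addHaar : Measure (Ket ι)) :=
  integrable_exp_neg_norm_sq.ofReal.bdd_mul hf.aestronglyMeasurable
    (Filter.Eventually.of_forall hC)

/-- The splitting `ψ = W x + y` with `x = X ψ` and `X y = 0`, for a left inverse `X` of `W`, as a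
real-linear equivalence. -/
noncomputable def splitEquiv (X : Ket ι →ₗ[ℂ] Ket α) (W : Ket α →ₗ[ℂ] Ket ι)
    (hXW : ∀ x, X (W x) = x) : (Ket α × LinearMap.ker (X.restrictScalars ℝ)) ≃L[ℝ] Ket ι :=
  LinearEquiv.toContinuousLinearEquiv
    { toFun := fun p => W p.1 + p.2
      map_add' := fun p q => by
        simp only [Prod.fst_add, Prod.snd_add, map_add, Submodule.coe_add]
        abel
      map_smul' := fun r p => by
        have : W (r • p.1) = r • W p.1 := (W.restrictScalars ℝ).map_smul r p.1
        simp only [Prod.smul_fst, Prod.smul_snd, Submodule.coe_smul, smul_add, RingHom.id_apply,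
          this]
      invFun := fun ψ => (X ψ, ⟨ψ - W (X ψ), by simp [hXW]⟩)
      left_inv := fun p => by
        have h : X p.2 = 0 := p.2.2
        ext1
        · simp [hXW, h]
        · ext1
          simp [hXW, h]
      right_inv := fun ψ => by simp }

/-- Let `ψ` be Haar random and `ψ = W x + y` the orthogonal splitting along an isometry `W` with
adjoint `X`.  If `h` depends on `x` only through `‖x‖`, then `h ψ` is uncorrelated with every
function `g` of the direction of `x = X ψ`, and that direction is Haar random.  With a Gaussian
weight the integral over `ψ` becomes an iterated integral over `y` and `x`, and polar coordinates
in `x` factor out the average of `g`. -/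
theorem integral_mul_comp_haarState (X : Ket ι →ₗ[ℂ] Ket α) (W : Ket α →ₗ[ℂ] Ket ι)
    (hXW : ∀ x, X (W x) = x) (hnorm : ∀ x y, X y = 0 → ‖W x + y‖ ^ 2 = ‖x‖ ^ 2 + ‖y‖ ^ 2)
    {g : Ket α → ℂ} (hg : ∀ (r : ℝ) (x : Ket α), 0 < r → g (r • x) = g x)
    (hgm : Measurable g) {C : ℝ} (hgC : ∀ x, ‖g x‖ ≤ C)
    {h : Ket ι → ℂ} (hh : ∀ (r : ℝ) (x : Ket ι), 0 < r → h (r • x) = h x)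
    (hhm : Measurable h) {C' : ℝ} (hhC : ∀ x, ‖h x‖ ≤ C')
    (hrad : ∀ x x' y, X y = 0 → ‖x‖ = ‖x'‖ → h (W x + y) = h (W x' + y)) :
    ∫ ψ, h (ψ : Ket ι) * g (X ψ) ∂haarState ι =
      (∫ χ, g (χ : Ket α) ∂haarState α) * ∫ ψ, h (ψ : Ket ι) ∂haarState ι := by
  have hX : Measurable X := X.continuous_of_finiteDimensional.measurable
  have hZ := integral_exp_neg_norm_sq_ne_zero (ι := ι)
  have hXr : ∀ (r : ℝ) (x : Ket ι), X (r • x) = r • X x := (X.restrictScalars ℝ).map_smul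
  have e1 := integral_angular_mul_radial_eq_haarState (fun ψ : Ket ι => h ψ * g (X ψ))
    (fun r x hr => by rw [hXr, hh r x hr, hg r _ hr]) (fun r => (Real.exp (-r ^ 2) : ℂ))
  have e2 := integral_angular_mul_radial_eq_haarState h hh (fun r => (Real.exp (-r ^ 2) : ℂ))
  have i1 := integrable_bounded_mul_exp_neg_norm_sq (f := fun ψ : Ket ι => h ψ * g (X ψ))
    (hhm.mul (hgm.comp hX)) (C := C' * C) fun x => by
      rw [norm_mul]
      exact mul_le_mul (hhC _) (hgC _) (norm_nonneg _) ((norm_nonneg _).trans (hhC x))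
  have i2 := integrable_bounded_mul_exp_neg_norm_sq hhm hhC
  let K := LinearMap.ker (X.restrictScalars ℝ)
  let ν : Measure K := Measure.addHaar
  obtain ⟨c, hc, hint⟩ := (splitEquiv X W hXW).exists_integral_comp_eq
    ((Measure.addHaar : Measure (Ket α)).prod ν) (Measure.addHaar : Measure (Ket ι))
  have hc' : (c : ℂ) ≠ 0 := by exact_mod_cast hc
  obtain ⟨u, hu⟩ : ∃ u : Ket α, ‖u‖ = 1 := exists_norm_eq _ zero_le_one
  -- For fixed `y` the integrand is `g x` times a function of `‖x‖`; the unit vector `u` serves to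
  -- write the latter as an explicit function of the radius.
  have fiber : ∀ y : K,
      ∫ x, h (W x + y) * g (X (W x + y)) * (Real.exp (-‖W x + (y : Ket ι)‖ ^ 2) : ℂ)
        ∂(Measure.addHaar : Measure (Ket α)) =
      (∫ χ, g (χ : Ket α) ∂haarState α) *
        ∫ x, h (W x + y) * (Real.exp (-‖W x + (y : Ket ι)‖ ^ 2) : ℂ)
          ∂(Measure.addHaar : Measure (Ket α)) := by
    intro y
    have hy : X y = 0 := y.2
    have e3 := integral_angular_mul_radial_eq_haarState g hg
      (fun r => h (W (r • u) + y) * (Real.exp (-(r ^ 2 + ‖(y : Ket ι)‖ ^ 2)) : ℂ))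
    have hH : ∀ x : Ket α, h (W x + y) = h (W (‖x‖ • u) + y) := fun x =>
      hrad _ _ _ hy (by rw [norm_smul, hu, mul_one, norm_norm])
    simp only [← hH] at e3
    simp only [hnorm _ _ hy, map_add, hXW, hy, add_zero]
    rw [← e3]
    refine integral_congr_ae (Filter.Eventually.of_forall fun x => ?_)
    ring
  have key : ∫ ψ, h ψ * g (X ψ) * (Real.exp (-‖ψ‖ ^ 2) : ℂ) ∂(Measure.addHaar : Measure (Ket ι)) =
      (∫ χ, g (χ : Ket α) ∂haarState α) *
        ∫ ψ, h ψ * (Real.exp (-‖ψ‖ ^ 2) : ℂ) ∂(Measure.addHaar : Measure (Ket ι)) := by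
    apply mul_left_cancel₀ hc'
    rw [mul_left_comm, ← (hint _).1, ← (hint _).1, integral_prod_symm _ ((hint _).2 i1),
      integral_prod_symm _ ((hint _).2 i2), ← integral_const_mul]
    exact integral_congr_ae (Filter.Eventually.of_forall fiber)
  rw [e1, e2, ← mul_assoc] at key
  exact mul_right_cancel₀ hZ key

end Compression

/-! ### Projected states -/

section ProjectedDirection

variable {ι α : Type*} [Fintype ι] [Fintype α]

/-- The normalized image `K ψ / ‖K ψ‖` of a state under an operator (zero if `K ψ = 0`). -/
noncomputable def normalizedImage (K : Ket ι →ₗ[ℂ] Ket ι) (ψ : Ket ι) : Ket ι :=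
  ((‖K ψ‖⁻¹ : ℝ) : ℂ) • K ψ

theorem norm_normalizedImage (K : Ket ι →ₗ[ℂ] Ket ι) {ψ : Ket ι} (h : K ψ ≠ 0) :
    ‖normalizedImage K ψ‖ = 1 := by
  rw [normalizedImage, norm_smul, Complex.norm_real, norm_inv, norm_norm,
    inv_mul_cancel₀ (norm_ne_zero_iff.2 h)]

theorem norm_normalizedImage_le_one (K : Ket ι →ₗ[ℂ] Ket ι) (ψ : Ket ι) :
    ‖normalizedImage K ψ‖ ≤ 1 := by
  by_cases h : K ψ = 0
  · simp [normalizedImage, h]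
  · exact (norm_normalizedImage K h).le

theorem measurable_normalizedImage (K : Ket ι →ₗ[ℂ] Ket ι) : Measurable (normalizedImage K) := by
  have hK : Measurable K := K.continuous_of_finiteDimensional.measurable
  unfold normalizedImage
  fun_prop

theorem normalizedImage_smul (K : Ket ι →ₗ[ℂ] Ket ι) (r : ℝ) (ψ : Ket ι) (hr : 0 < r) :
    normalizedImage K (r • ψ) = normalizedImage K ψ := by
  have h : K (r • ψ) = (r : ℂ) • K ψ := by rw [← Complex.coe_smul, map_smul]
  have hr' : (r : ℂ) ≠ 0 := by exact_mod_cast hr.ne'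
  rw [normalizedImage, normalizedImage, h, norm_smul, Complex.norm_real, Real.norm_of_nonneg hr.le,
    smul_smul, mul_inv, Complex.ofReal_mul, Complex.ofReal_inv r, mul_right_comm,
    inv_mul_cancel₀ hr', one_mul]

/-- The kernel of a nonzero operator is a null set, so the normalized image is almost surely a
unit vector. -/
theorem integral_norm_normalizedImage_sq [Nonempty ι] (K : Ket ι →ₗ[ℂ] Ket ι) (hK : K ≠ 0) :
    ∫ ψ : Metric.sphere (0 : Ket ι) 1, ((‖normalizedImage K ψ‖ ^ 2 : ℝ) : ℂ) ∂haarState ι = 1 := by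
  have hpolar := integral_angular_mul_radial_eq_haarState
    (fun ψ : Ket ι => ((‖normalizedImage K ψ‖ ^ 2 : ℝ) : ℂ))
    (fun r x hr => by rw [normalizedImage_smul K r x hr]) (fun r => (Real.exp (-r ^ 2) : ℂ))
  have hnull : (Measure.addHaar : Measure (Ket ι)) (LinearMap.ker (K.restrictScalars ℝ)) = 0 := by
    refine Measure.addHaar_submodule _ _ fun h => hK ?_
    ext1 x
    have : x ∈ LinearMap.ker (K.restrictScalars ℝ) := h ▸ Submodule.mem_top
    exact this
  have hae : ∫ ψ : Ket ι, ((‖normalizedImage K ψ‖ ^ 2 : ℝ) : ℂ) * (Real.exp (-‖ψ‖ ^ 2) : ℂ)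
      ∂(Measure.addHaar : Measure (Ket ι)) =
      ∫ ψ : Ket ι, (Real.exp (-‖ψ‖ ^ 2) : ℂ) ∂(Measure.addHaar : Measure (Ket ι)) := by
    refine integral_congr_ae ?_
    filter_upwards [measure_eq_zero_iff_ae_notMem.1 hnull] with ψ hψ
    have : K ψ ≠ 0 := hψ
    simp [norm_normalizedImage K this]
  rw [hae] at hpolar
  exact mul_right_cancel₀ integral_exp_neg_norm_sq_ne_zero (by rw [← hpolar, one_mul])

/-- A matrix element of the contribution `(|v⟩⟨v|)^{⊗ t} / ‖v‖^{2(t-1)}` of a measurement outcome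
with unnormalized post-measurement state `v`; it is `0` for `v = 0` and `t ≥ 1`. -/
noncomputable def outcomeMoment {t : ℕ} (i j : Fin t → α) (v : Ket α) : ℂ :=
  (((‖v‖ ^ 2) ^ (t - 1) : ℝ) : ℂ)⁻¹ * tensorPow t (ketBra v) i j

/-- A matrix element of `(|v⟩⟨v|)^{⊗ t} / ‖v‖^{2t}`, a scale-invariant function of `v`. -/
noncomputable def directionMoment {t : ℕ} (i j : Fin t → α) (v : Ket α) : ℂ :=
  ((‖v‖ ^ (2 * t) : ℝ) : ℂ)⁻¹ * tensorPow t (ketBra v) i j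

theorem directionMoment_smul {t : ℕ} (i j : Fin t → α) (r : ℝ) (v : Ket α) (hr : 0 < r) :
    directionMoment i j (r • v) = directionMoment i j v := by
  have h : r • v = (r : ℂ) • v := (Complex.coe_smul r v).symm
  have h' : ((‖(r : ℂ)‖ ^ (2 * t) : ℝ) : ℂ) ≠ 0 := by
    rw [Complex.ofReal_ne_zero]
    exact pow_ne_zero _ (norm_ne_zero_iff.2 (by exact_mod_cast hr.ne'))
  rw [directionMoment, directionMoment, h, tensorPow_ketBra_smul, Matrix.smul_apply, norm_smul,
    mul_pow, smul_eq_mul, Complex.ofReal_mul]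
  field_simp

theorem norm_directionMoment_le_one {t : ℕ} (i j : Fin t → α) (v : Ket α) :
    ‖directionMoment i j v‖ ≤ 1 := by
  rw [directionMoment, norm_mul, norm_inv, Complex.norm_real, Real.norm_of_nonneg (by positivity)]
  exact inv_mul_le_one_of_le₀ (norm_tensorPow_ketBra_le v i j) (by positivity)

theorem measurable_directionMoment {t : ℕ} (i j : Fin t → α) :
    Measurable (directionMoment i j) := by
  have := (continuous_tensorPow_ketBra i j).measurable
  unfold directionMoment
  fun_prop

theorem measurable_outcomeMoment {t : ℕ} (i j : Fin t → α) : Measurable (outcomeMoment i j) := by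
  have := (continuous_tensorPow_ketBra i j).measurable
  unfold outcomeMoment
  fun_prop

theorem integral_directionMoment {t : ℕ} (i j : Fin t → α) :
    ∫ χ : Metric.sphere (0 : Ket α) 1, directionMoment i j χ ∂haarState α =
      haarMoment α t i j := by
  rw [haarMoment, Matrix.of_apply]
  refine integral_congr_ae (Filter.Eventually.of_forall fun ψ => ?_)
  simp [directionMoment]

/-- An outcome contributes the moment of its direction, weighted by its probability.  For `t ≥ 1`
this includes the outcomes of probability zero. -/
theorem outcomeMoment_eq {t : ℕ} (ht : 1 ≤ t) (i j : Fin t → α) (v : Ket α) :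
    outcomeMoment i j v = ((‖v‖ ^ 2 : ℝ) : ℂ) * directionMoment i j v := by
  by_cases hv : v = 0
  · have : tensorPow t (ketBra v) i j = 0 := by
      refine norm_le_zero_iff.1 ((norm_tensorPow_ketBra_le v i j).trans ?_)
      rw [hv, norm_zero, zero_pow (by omega)]
    rw [outcomeMoment, directionMoment, this, mul_zero, mul_zero, mul_zero]
  · have hv' : ((‖v‖ : ℝ) : ℂ) ≠ 0 := by exact_mod_cast norm_ne_zero_iff.2 hv
    obtain ⟨s, rfl⟩ : ∃ s, t = s + 1 := ⟨t - 1, by omega⟩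
    rw [outcomeMoment, directionMoment, Nat.add_sub_cancel]
    push_cast
    rw [← mul_assoc, mul_add, pow_add, ← pow_mul]
    field_simp

/-- Let `K` be a multiple of an orthogonal projection and `L` a map to a smaller space with
adjoint `V`, such that `L K V = 1`.  For a Haar random `ψ` and `φ = K ψ / ‖K ψ‖`, the direction of
`L φ` is Haar random and independent of its norm, so the moment of the outcome is the Haar moment
times the mean probability of the outcome. -/
theorem integral_outcomeMoment_normalizedImage [Nonempty ι] [Nonempty α]
    (K : Ket ι →ₗ[ℂ] Ket ι) (L : Ket ι →ₗ[ℂ] Ket α) (V : Ket α →ₗ[ℂ] Ket ι) {n : ℝ} (hn : 0 < n)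
    (hKsymm : K.IsSymmetric) (hKK : ∀ x, K (K x) = (n : ℂ) • K x)
    (hVL : ∀ w φ, inner ℂ (V w) φ = inner ℂ w (L φ)) (hLKV : ∀ w, L (K (V w)) = w)
    (hL : ∀ φ, ‖L φ‖ ≤ ‖φ‖) {t : ℕ} (ht : 1 ≤ t) (i j : Fin t → α) :
    ∫ ψ : Metric.sphere (0 : Ket ι) 1, outcomeMoment i j (L (normalizedImage K ψ)) ∂haarState ι =
      haarMoment α t i j *
        ∫ ψ : Metric.sphere (0 : Ket ι) 1, ((‖L (normalizedImage K ψ)‖ ^ 2 : ℝ) : ℂ)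
          ∂haarState ι := by
  -- `X = L K / √n` is a coisometry with adjoint `W = K V / √n`, and both intertwine `K` with `n`.
  set c : ℂ := (((√n)⁻¹ : ℝ) : ℂ) with hcdef
  have hsq : 0 < √n := Real.sqrt_pos.2 hn
  have hcn : c * c * n = 1 := by
    rw [hcdef, ← Complex.ofReal_mul, ← Complex.ofReal_mul]
    norm_cast
    nth_rewrite 3 [← Real.mul_self_sqrt hn.le]
    field_simp
  let X : Ket ι →ₗ[ℂ] Ket α := c • (L ∘ₗ K)
  let W : Ket α →ₗ[ℂ] Ket ι := c • (K ∘ₗ V)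
  have hX : ∀ x, X x = c • L (K x) := fun _ => rfl
  have hW : ∀ x, W x = c • K (V x) := fun _ => rfl
  have hXW : ∀ x, X (W x) = x := fun x => by
    rw [hX, hW, map_smul, map_smul, hKK, map_smul, hLKV, smul_smul, smul_smul, hcn, one_smul]
  have hXK : ∀ y, X (K y) = (n : ℂ) • X y := fun y => by
    rw [hX, hX, hKK, map_smul, smul_comm]
  have hKW : ∀ x, K (W x) = W ((n : ℂ) • x) := fun x => by
    rw [hW, hW, map_smul, hKK, map_smul, map_smul]
  have hWX : ∀ x y, inner ℂ (W x) y = inner ℂ x (X y) := fun x y => by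
    rw [hX, hW, inner_smul_left, inner_smul_right, hKsymm, hVL, hcdef, Complex.conj_ofReal]
  have hWnorm : ∀ x, ‖W x‖ = ‖x‖ := fun x => by
    have : (inner ℂ (W x) (W x) : ℂ) = inner ℂ x x := by rw [hWX, hXW]
    rw [inner_self_eq_norm_sq_to_K, inner_self_eq_norm_sq_to_K] at this
    have : ‖W x‖ ^ 2 = ‖x‖ ^ 2 := by exact_mod_cast this
    exact (sq_eq_sq₀ (norm_nonneg _) (norm_nonneg _)).1 this
  have hnorm : ∀ x y, X y = 0 → ‖W x + y‖ ^ 2 = ‖x‖ ^ 2 + ‖y‖ ^ 2 := fun x y hy => by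
    have h0 : (inner ℂ (W x) y : ℂ) = 0 := by rw [hWX, hy, inner_zero_right]
    rw [sq, sq, sq, norm_add_sq_eq_norm_sq_add_norm_sq_of_inner_eq_zero _ _ h0, hWnorm]
  have hLφ : ∀ ψ, L (normalizedImage K ψ) = (‖K ψ‖⁻¹ * √n) • X ψ := fun ψ => by
    have : ((‖K ψ‖⁻¹ * √n : ℝ) : ℂ) * c = ((‖K ψ‖⁻¹ : ℝ) : ℂ) := by
      rw [hcdef, ← Complex.ofReal_mul, mul_assoc, mul_inv_cancel₀ hsq.ne', mul_one]
    rw [normalizedImage, map_smul, hX, ← Complex.coe_smul, smul_smul, this]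
  -- `‖K (W x + y)‖² = n² ‖x‖² + ‖K y‖²`, so the probability depends on `x` only through `‖x‖`.
  have hrad : ∀ x x' y, X y = 0 → ‖x‖ = ‖x'‖ →
      ((‖L (normalizedImage K (W x + y))‖ ^ 2 : ℝ) : ℂ) =
        ((‖L (normalizedImage K (W x' + y))‖ ^ 2 : ℝ) : ℂ) := by
    intro x x' y hy hxx
    have hK2 : ∀ x, ‖K (W x + y)‖ ^ 2 = ‖(n : ℂ)‖ ^ 2 * ‖x‖ ^ 2 + ‖K y‖ ^ 2 := fun x => by
      rw [map_add, hKW, hnorm _ _ (by rw [hXK, hy, smul_zero]), norm_smul, mul_pow]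
    have hKeq : ‖K (W x + y)‖ = ‖K (W x' + y)‖ := by
      rw [← sq_eq_sq₀ (norm_nonneg _) (norm_nonneg _), hK2, hK2, hxx]
    simp only [hLφ, norm_smul, map_add, hXW, hy, add_zero, hxx]
    rw [← map_add, ← map_add, hKeq]
  have hmeas : Measurable fun ψ : Ket ι => ((‖L (normalizedImage K ψ)‖ ^ 2 : ℝ) : ℂ) := by
    have h1 : Measurable L := L.continuous_of_finiteDimensional.measurable
    have h2 := measurable_normalizedImage K
    fun_prop
  have hbound : ∀ ψ : Ket ι, ‖((‖L (normalizedImage K ψ)‖ ^ 2 : ℝ) : ℂ)‖ ≤ 1 := fun ψ => by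
    rw [Complex.norm_real, norm_pow, norm_norm]
    exact pow_le_one₀ (norm_nonneg _) ((hL _).trans (norm_normalizedImage_le_one K ψ))
  have main := integral_mul_comp_haarState X W hXW hnorm (directionMoment_smul i j)
    (measurable_directionMoment i j) (norm_directionMoment_le_one i j)
    (fun r x hr => by rw [normalizedImage_smul K r x hr]) hmeas hbound hrad
  rw [integral_directionMoment] at main
  rw [← main]
  refine integral_congr_ae (Filter.Eventually.of_forall fun ψ => ?_)
  simp only
  rw [outcomeMoment_eq ht]
  by_cases hψ : K ψ = 0
  · simp [normalizedImage, hψ]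
  · rw [hLφ, directionMoment_smul i j _ _ (mul_pos (inv_pos.2 (norm_pos_iff.2 hψ)) hsq)]

end ProjectedDirection

/-! ### The momentum operator -/

section Translation

variable (d N : ℕ)

/-- The translation `(i₁, …, i_N) ↦ (i_N, i₁, …, i_{N-1})` of basis labels. -/
def translateConfig : Equiv.Perm (Config d N) := (finRotate N).arrowCongr (Equiv.refl (Fin d))

theorem finRotate_pow_self : finRotate N ^ N = 1 := by
  cases N with
  | zero => rfl
  | succ n =>
    have h : ∀ (k : ℕ) (i : Fin (n + 1)), (finRotate (n + 1) ^ k) i = i + k • 1 := fun k => by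
      induction k with
      | zero => intro i; simp
      | succ k ih =>
        intro i
        rw [pow_succ', Equiv.Perm.mul_apply, ih, finRotate_apply, succ_nsmul, add_assoc]
    ext1 i
    have h1 : (n + 1) • (1 : Fin (n + 1)) = 0 := by
      simpa using card_nsmul_eq_zero (x := (1 : Fin (n + 1)))
    rw [h, h1, add_zero, Equiv.Perm.one_apply]

theorem translateConfig_pow_self : translateConfig d N ^ N = 1 := by
  have h : ∀ k : ℕ, translateConfig d N ^ k =
      (finRotate N ^ k).arrowCongr (Equiv.refl (Fin d)) := fun k => by
    induction k with
    | zero => rfl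
    | succ k ih =>
      rw [pow_succ', ih, pow_succ']
      rfl
  rw [h, finRotate_pow_self]
  rfl

/-- The inverse appears because `σ.permMatrix` maps the basis vector labelled `σ c` to the one
labelled `c`. -/
theorem translation_eq_permMatrix :
    translation d N = (translateConfig d N)⁻¹.permMatrix ℂ := by
  ext i' i
  rw [translation, Matrix.of_apply, Equiv.Perm.permMatrix, PEquiv.toMatrix_apply,
    Equiv.toPEquiv_apply]
  congr 1
  rw [Option.mem_some_iff, Equiv.Perm.inv_eq_iff_eq]
  rfl

theorem translation_conjTranspose_mul_self : (translation d N)ᴴ * translation d N = 1 := by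
  rw [translation_eq_permMatrix, Matrix.conjTranspose_permMatrix, ← Matrix.permMatrix_mul,
    mul_inv_cancel, Matrix.permMatrix_one]

theorem translation_pow_self : translation d N ^ N = 1 := by
  have h : ∀ k : ℕ, translation d N ^ k = ((translateConfig d N)⁻¹ ^ k).permMatrix ℂ := fun k => by
    induction k with
    | zero => rw [pow_zero, pow_zero, Matrix.permMatrix_one]
    | succ k ih => rw [pow_succ, ih, translation_eq_permMatrix, ← Matrix.permMatrix_mul, pow_succ']
  rw [h, inv_pow, translateConfig_pow_self, inv_one, Matrix.permMatrix_one]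

/-- `T_k` is the sum of the powers of the unitary `Z = e^{2πik/N} T`, which satisfies `Z^N = 1`. -/
theorem exists_momentumOp_eq_geom_sum (k : ℕ) (hN : 0 < N) :
    ∃ Z : Matrix (Config d N) (Config d N) ℂ, Zᴴ * Z = 1 ∧ Z ^ N = 1 ∧
      momentumOp d N k = ∑ j ∈ Finset.range N, Z ^ j := by
  have hN' : (N : ℂ) ≠ 0 := by exact_mod_cast hN.ne'
  set ω : ℂ := Complex.exp ((2 * Real.pi * k / N : ℝ) * Complex.I) with hω
  refine ⟨ω • translation d N, ?_, ?_, ?_⟩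
  · rw [Matrix.conjTranspose_smul, smul_mul_smul_comm, translation_conjTranspose_mul_self,
      Complex.star_def, Complex.conj_mul', Complex.norm_exp_ofReal_mul_I]
    simp
  · rw [smul_pow, translation_pow_self, hω, ← Complex.exp_nat_mul,
      show (N : ℂ) * ((2 * Real.pi * k / N : ℝ) * Complex.I) = k * (2 * Real.pi * Complex.I) by
        push_cast
        field_simp,
      Complex.exp_nat_mul_two_pi_mul_I, one_smul]
  · refine Finset.sum_congr rfl fun j _ => ?_
    rw [smul_pow, hω, ← Complex.exp_nat_mul]
    congr 2
    push_cast
    ring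

/-- Since `Z T_k = T_k = Zᴴ T_k`, the operator `T_k / N` is an orthogonal projection. -/
theorem momentumOp_conjTranspose_mul_self (k : ℕ) (hN : 0 < N) :
    (momentumOp d N k)ᴴ * momentumOp d N k = (N : ℂ) • momentumOp d N k := by
  obtain ⟨Z, hZ, hZN, hK⟩ := exists_momentumOp_eq_geom_sum d N k hN
  have h1 : Z * momentumOp d N k = momentumOp d N k := by
    have := mul_geom_sum Z N
    rw [hZN, sub_self, ← hK, sub_mul, one_mul, sub_eq_zero] at this
    exact this
  have h2 : Zᴴ * momentumOp d N k = momentumOp d N k := by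
    conv_lhs => rw [← h1]
    rw [← Matrix.mul_assoc, hZ, Matrix.one_mul]
  have h3 : ∀ j : ℕ, (Z ^ j)ᴴ * momentumOp d N k = momentumOp d N k := fun j => by
    induction j with
    | zero => rw [pow_zero, Matrix.conjTranspose_one, Matrix.one_mul]
    | succ j ih => rw [pow_succ, Matrix.conjTranspose_mul, Matrix.mul_assoc, ih, h2]
  nth_rewrite 1 [hK]
  rw [Matrix.conjTranspose_sum, Finset.sum_mul, Finset.sum_congr rfl fun j _ => h3 j,
    Finset.sum_const, Finset.card_range, Nat.cast_smul_eq_nsmul]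

theorem momentumOp_isHermitian (k : ℕ) (hN : 0 < N) : (momentumOp d N k).IsHermitian := by
  have h := momentumOp_conjTranspose_mul_self d N k hN
  have h' := congrArg Matrix.conjTranspose h
  rw [Matrix.conjTranspose_mul, Matrix.conjTranspose_conjTranspose, h, Matrix.conjTranspose_smul,
    Complex.star_def, Complex.conj_natCast] at h'
  exact (smul_right_injective _ (by exact_mod_cast hN.ne' : (N : ℂ) ≠ 0) h').symm

theorem momentumOp_mul_self (k : ℕ) (hN : 0 < N) :
    momentumOp d N k * momentumOp d N k = (N : ℂ) • momentumOp d N k := by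
  have := momentumOp_conjTranspose_mul_self d N k hN
  rwa [momentumOp_isHermitian d N k hN] at this

end Translation

/-! ### Measurement of the subsystem `B` -/

section Measurement

variable {d NA NB : ℕ}

theorem sum_config_add {M : Type*} [AddCommMonoid M] (f : Config d (NA + NB) → M) :
    ∑ c, f c = ∑ a : Config d NA, ∑ s : Config d NB, f (Fin.append a s) := by
  rw [← (Fin.appendEquiv NA NB).sum_comp, Fintype.sum_prod_type]
  rfl

theorem toEuclideanLin_apply_apply {m n : Type*} [Fintype n] [DecidableEq n] (M : Matrix m n ℂ)
    (x : Ket n) (i : m) : Matrix.toEuclideanLin M x i = ∑ j, M i j * x j := rfl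

theorem partialOverlap_apply (b : Ket (Config d NB)) (φ : Ket (Config d (NA + NB)))
    (a : Config d NA) :
    partialOverlap b φ a = ∑ s : Config d NB, star (b s) * φ (Fin.append a s) := rfl

/-- The linear map `φ ↦ (I_A ⊗ ⟨b|) φ`. -/
def partialOverlapLin (b : Ket (Config d NB)) :
    Ket (Config d (NA + NB)) →ₗ[ℂ] Ket (Config d NA) where
  toFun := partialOverlap b
  map_add' φ χ := by
    ext a
    simp [partialOverlap_apply, mul_add, Finset.sum_add_distrib]
  map_smul' r φ := by
    ext a
    simp [partialOverlap_apply, Finset.mul_sum, mul_left_comm]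

theorem partialOverlapLin_apply (b : Ket (Config d NB)) (φ : Ket (Config d (NA + NB))) :
    partialOverlapLin b φ = partialOverlap b φ := rfl

/-- The linear map `w ↦ w ⊗ |b⟩`. -/
def tensorKetLin (b : Ket (Config d NB)) :
    Ket (Config d NA) →ₗ[ℂ] Ket (Config d (NA + NB)) where
  toFun w := WithLp.toLp 2 fun c =>
    w (fun i => c (Fin.castAdd NB i)) * b fun i => c (Fin.natAdd NA i)
  map_add' w w' := by
    ext c
    simp [add_mul]
  map_smul' r w := by
    ext c
    simp [mul_assoc]

theorem tensorKetLin_append (b : Ket (Config d NB)) (w : Ket (Config d NA)) (a : Config d NA)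
    (s : Config d NB) : tensorKetLin b w (Fin.append a s) = w a * b s := by
  simp [tensorKetLin]

theorem inner_tensorKetLin (b : Ket (Config d NB)) (w : Ket (Config d NA))
    (φ : Ket (Config d (NA + NB))) :
    inner ℂ (tensorKetLin b w) φ = inner ℂ w (partialOverlapLin b φ) := by
  rw [PiLp.inner_apply, PiLp.inner_apply, sum_config_add]
  refine Finset.sum_congr rfl fun a _ => ?_
  rw [partialOverlapLin_apply, partialOverlap_apply, RCLike.inner_apply, Finset.sum_mul]
  refine Finset.sum_congr rfl fun s _ => ?_
  rw [tensorKetLin_append, RCLike.inner_apply, map_mul, ← Complex.star_def]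
  ring

/-- `⟨b| M |b⟩` is the composition of `w ↦ w ⊗ |b⟩`, `M`, and `φ ↦ ⟨b|φ⟩`. -/
theorem partialOverlapLin_tensorKetLin (b : Ket (Config d NB))
    (M : Matrix (Config d (NA + NB)) (Config d (NA + NB)) ℂ) (w : Ket (Config d NA)) :
    partialOverlapLin b (Matrix.toEuclideanLin M (tensorKetLin b w)) =
      Matrix.toEuclideanLin (partialExpectation b M) w := by
  ext a
  rw [partialOverlapLin_apply, partialOverlap_apply, toEuclideanLin_apply_apply]
  simp only [toEuclideanLin_apply_apply, sum_config_add, tensorKetLin_append, partialExpectation,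
    Matrix.of_apply, Finset.mul_sum, Finset.sum_mul]
  rw [Finset.sum_comm]
  refine Finset.sum_congr rfl fun a' _ => Finset.sum_congr rfl fun s _ =>
    Finset.sum_congr rfl fun s' _ => ?_
  ring

/-- The outcome probabilities of a measurement in an orthonormal basis add up to `‖φ‖²`. -/
theorem sum_norm_partialOverlap_sq {κ : Type*} [Fintype κ]
    (𝓑 : OrthonormalBasis κ ℂ (Ket (Config d NB))) (φ : Ket (Config d (NA + NB))) :
    ∑ b, ‖partialOverlap (𝓑 b) φ‖ ^ 2 = ‖φ‖ ^ 2 := by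
  simp only [EuclideanSpace.norm_sq_eq]
  rw [Finset.sum_comm, sum_config_add]
  refine Finset.sum_congr rfl fun a _ => ?_
  have h := 𝓑.sum_sq_norm_inner_right (WithLp.toLp 2 fun s => φ (Fin.append a s))
  rw [EuclideanSpace.norm_sq_eq] at h
  rw [← h]
  refine Finset.sum_congr rfl fun b _ => ?_
  rw [partialOverlap_apply, PiLp.inner_apply]
  simp only [RCLike.inner_apply, Complex.star_def, mul_comm]

theorem norm_partialOverlap_le {κ : Type*} [Fintype κ]
    (𝓑 : OrthonormalBasis κ ℂ (Ket (Config d NB))) (b : κ) (φ : Ket (Config d (NA + NB))) :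
    ‖partialOverlap (𝓑 b) φ‖ ≤ ‖φ‖ := by
  rw [← sq_le_sq₀ (norm_nonneg _) (norm_nonneg _), ← sum_norm_partialOverlap_sq 𝓑 φ]
  exact Finset.single_le_sum (f := fun b => ‖partialOverlap (𝓑 b) φ‖ ^ 2)
    (fun _ _ => sq_nonneg _) (Finset.mem_univ b)

theorem projectedMoment_apply {κ : Type*} [Fintype κ]
    (𝓑 : OrthonormalBasis κ ℂ (Ket (Config d NB))) (t : ℕ) (φ : Ket (Config d (NA + NB)))
    (i j : Fin t → Config d NA) :
    projectedMoment 𝓑 t φ i j = ∑ b, outcomeMoment i j (partialOverlapLin (𝓑 b) φ) := by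
  rw [projectedMoment, Matrix.sum_apply]
  rfl

theorem norm_outcomeMoment_le {α : Type*} [Fintype α] {t : ℕ} (ht : 1 ≤ t) (i j : Fin t → α)
    (v : Ket α) : ‖outcomeMoment i j v‖ ≤ ‖v‖ ^ 2 := by
  rw [outcomeMoment_eq ht, norm_mul, Complex.norm_real, norm_pow, norm_norm]
  exact mul_le_of_le_one_right (sq_nonneg _) (norm_directionMoment_le_one i j v)

end Measurement

theorem mainTheorem2 (d NA NB : ℕ) (hd : 1 ≤ d) (k : ℕ) (hk : k < NA + NB)
    {κ : Type*} [Fintype κ] (𝓑 : OrthonormalBasis κ ℂ (Ket (Config d NB)))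
    (hB : ∀ b : κ, partialExpectation (NA := NA) (𝓑 b) (momentumOp d (NA + NB) k) = 1)
    (t : ℕ) (ht : 1 ≤ t) :
    (∀ i j : Fin t → Config d NA,
      Integrable (fun φ : Ket (Config d (NA + NB)) => projectedMoment 𝓑 t φ i j)
        (momentumEnsemble d (NA + NB) k)) ∧
    meanProjectedMoment 𝓑 NA t k = haarMoment (Config d NA) t ∧
    meanProjectedMoment 𝓑 NA t k =
      (∏ m ∈ Finset.range t, (((d ^ NA : ℕ) : ℂ) + (m : ℂ)))⁻¹ •
        symmetrizer (Config d NA) t := by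
  have : NeZero d := ⟨by omega⟩
  have hN : 0 < NA + NB := by omega
  set K := Matrix.toEuclideanLin (momentumOp d (NA + NB) k) with hKdef
  have hKm : Measurable fun ψ : Metric.sphere (0 : Ket (Config d (NA + NB))) 1 =>
      toMomentum d (NA + NB) k (ψ : Ket (Config d (NA + NB))) :=
    (measurable_normalizedImage K).comp measurable_subtype_coe
  have hKK : ∀ x, K (K x) = (((NA + NB : ℕ) : ℝ) : ℂ) • K x := fun x => by
    have h : Matrix.toEuclideanLin (momentumOp d (NA + NB) k * momentumOp d (NA + NB) k) x =
        K (K x) := by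
      ext c
      simp [hKdef, Matrix.toEuclideanLin, Matrix.mulVec_mulVec]
    rw [← h, momentumOp_mul_self d _ k hN, map_smul, LinearMap.smul_apply, Complex.ofReal_natCast]
  have hKsymm : K.IsSymmetric :=
    Matrix.isSymmetric_toEuclideanLin_iff.2 (momentumOp_isHermitian d _ k hN)
  have hLKV : ∀ b w, partialOverlapLin (𝓑 b) (K (tensorKetLin (𝓑 b) w)) = w := fun b w => by
    rw [partialOverlapLin_tensorKetLin, hB]
    ext a
    simp [Matrix.toEuclideanLin]
  have hLm : ∀ b, Measurable (partialOverlapLin (NA := NA) (𝓑 b)) := fun b =>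
    (partialOverlapLin (NA := NA) (𝓑 b)).continuous_of_finiteDimensional.measurable
  have hOm : ∀ (i j : Fin t → Config d NA) (b : κ),
      Measurable fun φ => outcomeMoment i j (partialOverlapLin (𝓑 b) φ) := fun i j b =>
    (measurable_outcomeMoment i j).comp (hLm b)
  have hterm : ∀ (i j : Fin t → Config d NA) (b : κ),
      Integrable (fun φ => outcomeMoment i j (partialOverlapLin (𝓑 b) φ))
        (momentumEnsemble d (NA + NB) k) := fun i j b => by
    rw [momentumEnsemble, integrable_map_measure (hOm i j b).aestronglyMeasurable
      hKm.aemeasurable]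
    refine Integrable.of_bound ((hOm i j b).comp hKm).aestronglyMeasurable 1
      (Filter.Eventually.of_forall fun ψ => (norm_outcomeMoment_le ht i j _).trans ?_)
    exact pow_le_one₀ (norm_nonneg _) ((norm_partialOverlap_le 𝓑 b _).trans
      (norm_normalizedImage_le_one K ψ))
  have hmean : meanProjectedMoment 𝓑 NA t k = haarMoment (Config d NA) t := by
    ext i j
    -- `⟨b| T_k |b⟩ = 1` on the nonzero space `H_A` forces `T_k ≠ 0`.
    have hK0 : K ≠ 0 := fun h => by
      obtain ⟨b⟩ : Nonempty κ := 𝓑.toBasis.index_nonempty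
      obtain ⟨w, hw⟩ := exists_ne (0 : Ket (Config d NA))
      refine hw ?_
      rw [← hLKV b w, h, LinearMap.zero_apply, map_zero]
    have hprob : ∀ b, Integrable (fun ψ : Metric.sphere (0 : Ket (Config d (NA + NB))) 1 =>
        ((‖partialOverlapLin (𝓑 b) (normalizedImage K ψ)‖ ^ 2 : ℝ) : ℂ))
        (haarState (Config d (NA + NB))) := fun b => by
      have h1 : Measurable fun ψ : Metric.sphere (0 : Ket (Config d (NA + NB))) 1 =>
        partialOverlapLin (NA := NA) (𝓑 b) (normalizedImage K ψ) := (hLm b).comp hKm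
      have h2 : Measurable fun ψ : Metric.sphere (0 : Ket (Config d (NA + NB))) 1 =>
        ((‖partialOverlapLin (NA := NA) (𝓑 b) (normalizedImage K ψ)‖ ^ 2 : ℝ) : ℂ) :=
          Complex.measurable_ofReal.comp (h1.norm.pow_const 2)
      refine Integrable.of_bound h2.aestronglyMeasurable 1 (Filter.Eventually.of_forall fun ψ => ?_)
      rw [Complex.norm_real, norm_pow, norm_norm]
      exact pow_le_one₀ (norm_nonneg _) ((norm_partialOverlap_le 𝓑 b _).trans
        (norm_normalizedImage_le_one K ψ))
    rw [meanProjectedMoment, Matrix.of_apply]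
    simp only [projectedMoment_apply]
    rw [integral_finsetSum _ fun b _ => hterm i j b]
    have hb : ∀ b, ∫ φ, outcomeMoment i j (partialOverlapLin (𝓑 b) φ)
        ∂(momentumEnsemble d (NA + NB) k) = haarMoment (Config d NA) t i j *
          ∫ ψ : Metric.sphere (0 : Ket (Config d (NA + NB))) 1,
            ((‖partialOverlapLin (𝓑 b) (normalizedImage K ψ)‖ ^ 2 : ℝ) : ℂ)
              ∂haarState (Config d (NA + NB)) := fun b => by
      rw [momentumEnsemble, integral_map hKm.aemeasurable
        (hOm i j b).aestronglyMeasurable]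
      exact integral_outcomeMoment_normalizedImage K (partialOverlapLin (𝓑 b))
        (tensorKetLin (𝓑 b)) (Nat.cast_pos.2 hN) hKsymm hKK (inner_tensorKetLin (𝓑 b)) (hLKV b)
        (norm_partialOverlap_le 𝓑 b) ht i j
    rw [Finset.sum_congr rfl fun b _ => hb b, ← Finset.mul_sum,
      ← integral_finsetSum _ fun b _ => hprob b]
    simp only [partialOverlapLin_apply, ← Complex.ofReal_sum, sum_norm_partialOverlap_sq]
    rw [integral_norm_normalizedImage_sq K hK0, mul_one]
  refine ⟨fun i j => ?_, hmean, ?_⟩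
  · simp only [projectedMoment_apply]
    exact integrable_finsetSum _ fun b _ => hterm i j b
  · rw [hmean, haarMoment_eq_symmetrizer, Fintype.card_fun, Fintype.card_fin, Fintype.card_fin]
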